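/- Call a finite poset $(2+2)$-free if it has no induced subposet isomorphic to the disjoint union of two $2$-element chains. For $n,k\ge 0$ let $p_{n,k}$ be the number of isomorphism classes of $(2+2)$-free posets with $n$ elements of which exactly $k$ are minimal. An ascent sequence of length $n$ is a sequence $(x_1,\dots,x_n)$ of non-negative integers with $x_1=0$ and $x_i\le 1+|\{1\le j<i-1 : x_j<x_{j+1}\}|$ for $2\le i\le n$ (the empty sequence is the ascent sequence of length $0$); let $a_{n,k}$ be the number of ascent sequences of length $n$ with exactly $k$ entries equal to $0$. Then, in the ring $\mathbb Z[[t,z]]$ of formal power series, the sum on the right-hand side below converges coefficientwise, and $$\sum_{n,k\ge 0} p_{n,k}\,t^n z^k=\sum_{n,k\ge 0} a_{n,k}\,t^n z^k = 1+\sum_{n\ge 0}\frac{zt}{(1-zt)^{n+1}}\prod_{i=1}^n\bigl(1-(1-t)^i\bigr).$$ -/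

import Mathlib

open scoped MvPowerSeries.WithPiTopology

namespace FishburnMin

/-- A poset is `(2+2)`-free if it has no induced subposet isomorphic to the disjoint union of two
2-element chains. (The order on `Fin 2 ⊕ Fin 2` is the disjoint-union order.) -/
def TwoPlusTwoFree (α : Type*) [PartialOrder α] : Prop :=
  IsEmpty ((Fin 2 ⊕ Fin 2) ↪o α)

/-- The number of minimal elements of a (finite) poset. -/
noncomputable def numMin (α : Type*) [PartialOrder α] : ℕ :=
  {x : α | IsMin x}.ncard

/-- The `(2+2)`-free partial orders on the set `Fin n` with `k` minimal elements. -/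
def LabeledPoset (n k : ℕ) : Type :=
  {P : PartialOrder (Fin n) // @TwoPlusTwoFree (Fin n) P ∧ @numMin (Fin n) P = k}

/-- Isomorphism of partial orders on `Fin n`. -/
def isoSetoid (n k : ℕ) : Setoid (LabeledPoset n k) where
  r P Q := Nonempty (@OrderIso (Fin n) (Fin n) P.1.toLE Q.1.toLE)
  iseqv :=
    { refl := fun P => ⟨@OrderIso.refl (Fin n) P.1.toLE⟩
      symm := fun {P Q} h => h.map (@OrderIso.symm (Fin n) (Fin n) P.1.toLE Q.1.toLE)
      trans := fun {P Q R} h h' => h.elim fun e => h'.elim fun e' =>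
        ⟨@OrderIso.trans (Fin n) (Fin n) (Fin n) P.1.toLE Q.1.toLE R.1.toLE e e'⟩ }

/-- `p_{n,k}`: the number of unlabeled `(2+2)`-free posets of size `n` with `k` minimal elements,
that is, the number of isomorphism classes. -/
noncomputable def posetCount (n k : ℕ) : ℕ :=
  Nat.card (Quotient (isoSetoid n k))

/-- The number of ascents of a sequence: positions `j` with `x_j < x_{j+1}`. -/
def asc (x : List ℕ) : ℕ :=
  (x.zip x.tail).countP fun q => q.1 < q.2

/-- Ascent sequences: the first entry (if any) is `0`, and every later entry is at most one more
than the number of ascents of the sequence of entries before it. -/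
def IsAscentSeq (x : List ℕ) : Prop :=
  (∀ h : 0 < x.length, x[0] = 0) ∧
    ∀ (i : ℕ) (h : i < x.length), 0 < i → x[i] ≤ 1 + asc (x.take i)

/-- The number of ascent sequences of length `n` with `k` zeros. -/
noncomputable def ascentCount (n k : ℕ) : ℕ :=
  Nat.card {x : List ℕ // IsAscentSeq x ∧ x.length = n ∧ x.count 0 = k}

/-- The formal power series `∑_{n,k} c n k t^n z^k`, where `t` is the variable `X 0` and `z` is the
variable `X 1`. -/
def genFun (c : ℕ → ℕ → ℕ) : MvPowerSeries (Fin 2) ℤ :=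
  fun d => (c (d 0) (d 1) : ℤ)

/-- The variable `t`. -/
noncomputable def t : MvPowerSeries (Fin 2) ℤ := MvPowerSeries.X 0

/-- The variable `z`. -/
noncomputable def z : MvPowerSeries (Fin 2) ℤ := MvPowerSeries.X 1

/-- The summand `zt / (1 - zt)^(n+1) * ∏_{i=1}^n (1 - (1-t)^i)`. The inverse of `1 - zt`, a power
series with constant coefficient `1`, is the inverse in the ring of formal power series. -/
noncomputable def term (n : ℕ) : MvPowerSeries (Fin 2) ℤ :=
  z * t * (MvPowerSeries.invOfUnit (1 - z * t) 1) ^ (n + 1) *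
    ∏ i ∈ Finset.Icc 1 n, (1 - (1 - t) ^ i)

end FishburnMin

/-! Posets and ascent sequences are never compared with each other. Each generating function is
evaluated on its own over any commutative ring with `t ^ (N + 1) = 0`, where all sums are finite;
`genFun_eq` applies this to power series modulo `t ^ (N + 1)`. Throughout, u = 1/(1-zt).

Ascent sequences grow by appending entries. The total weight W(a,l) of the continuations depends
only on the number a of ascents and the last entry l. Subtracting its recursions at l and l+1 leaves
(1-t)W(a,l+1) + tW(a+1,l+1) = W(a,l), which g^(a+1) r^l solves for g = 1/(1-X), r =
(1-X)/(1-(1-t)X); so does any linear functional L of it (`contWeight_succ`). The case l = 0 holds if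
(1-zt)L(k) = k(0) + L((k(X)-k((1-t)X))/X), and k = X^n then gives L(X^n) = u^(n+1)
∏_{i≤n}(1-(1-t)^i) (`moment_spec`, `contWeight_zero`). The answer is 1 + zt W(0,0).

In a (2+2)-free poset the strict down-sets form a chain, so every element gets an interval [`level`,
`reach`]. The multiset of intervals determines the poset up to isomorphism, and the multisets that
occur are those using each of m positions both as a left and as a right end (`posetCount_eq_card`).
Their multiplicities form an upper triangular matrix without zero rows or columns, with the minimal
elements in row 0. Inclusion-exclusion over zero rows (`sum_triMats`), followed by removal of the
top row (`altSum_succ`), shows that the sum F(A) over all sizes satisfies A F(A) = 1 + (Av-1)F(Av)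
with v = 1/(1-t). The series ∑ A^n ∏_{i≤n}(1-(1-t)^i) satisfies the same equation, whose solution is
unique because t divides Av-1 (`sum_altSum_eq`). The special weight of row 0 leads to A = u. -/

namespace FishburnMin

/-! ### The linear functional and the solution of the ascent recursion -/

section Algebra

variable {Q : Type*} [CommRing Q]

/-- The product `∏_{i=1}^n (1 - (1-t)^i)`. -/
def qfac (t : Q) (n : ℕ) : Q := ∏ i ∈ Finset.Icc 1 n, (1 - (1 - t) ^ i)

lemma qfac_zero (t : Q) : qfac t 0 = 1 := by simp [qfac]

lemma qfac_succ (t : Q) (n : ℕ) : qfac t (n + 1) = qfac t n * (1 - (1 - t) ^ (n + 1)) := by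
  rw [qfac, Finset.prod_Icc_succ_top (by omega), qfac]

lemma dvd_one_sub_one_sub_pow (t : Q) (i : ℕ) : t ∣ 1 - (1 - t) ^ i := by
  simpa using sub_dvd_pow_sub_pow (1 : Q) (1 - t) i

lemma pow_dvd_qfac (t : Q) (n : ℕ) : t ^ n ∣ qfac t n := by
  simpa [qfac] using
    Finset.prod_dvd_prod_of_dvd (s := Finset.Icc 1 n) (fun _ => t) (fun i => 1 - (1 - t) ^ i)
      fun i _ => dvd_one_sub_one_sub_pow t i

lemma eq_zero_of_pow_dvd {t x : Q} {N n : ℕ} (ht : t ^ (N + 1) = 0) (hn : N < n)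
    (h : t ^ n ∣ x) : x = 0 := by
  have h0 : t ^ n = 0 := pow_eq_zero_of_le hn ht
  rwa [h0, zero_dvd_iff] at h

/-- The coefficient functional on power series that sends `X ^ n` to `u ^ (n+1) * qfac t n`,
truncated at degree `N`. -/
noncomputable def moment (t u : Q) (N : ℕ) : PowerSeries Q →ₗ[Q] Q :=
  ∑ n ∈ Finset.range (N + 1), (u ^ (n + 1) * qfac t n) • PowerSeries.coeff n

lemma moment_apply (t u : Q) (N : ℕ) (f : PowerSeries Q) :
    moment t u N f =
      ∑ n ∈ Finset.range (N + 1), u ^ (n + 1) * qfac t n * PowerSeries.coeff n f := by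
  simp [moment, LinearMap.sum_apply]

lemma mul_moment (t u : Q) (N : ℕ) (c : Q) (f : PowerSeries Q) :
    c * moment t u N f = moment t u N (PowerSeries.C c * f) := by
  rw [← PowerSeries.smul_eq_C_mul, map_smul, smul_eq_mul]

/-- The geometric series `1 / (1 - c X)`. -/
noncomputable def geom (c : Q) : PowerSeries Q := PowerSeries.mk fun n => c ^ n

lemma geom_mul (c : Q) : geom c * (1 - PowerSeries.C c * PowerSeries.X) = 1 := by
  ext n
  rw [mul_sub, mul_one, ← mul_assoc, map_sub]
  cases n with
  | zero => simp [geom]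
  | succ n =>
    rw [PowerSeries.coeff_succ_mul_X, mul_comm, PowerSeries.coeff_C_mul]
    simp [geom, pow_succ', PowerSeries.coeff_one]

lemma rescale_geom_one (c : Q) : PowerSeries.rescale c (geom 1) = geom c := by
  ext n
  simp [geom, PowerSeries.coeff_rescale]

/-- The defining property of the functional `moment`. -/
lemma moment_spec {t z u : Q} {N : ℕ} (ht : t ^ (N + 1) = 0) (hu : (1 - z * t) * u = 1)
    {k f : PowerSeries Q} (hf : PowerSeries.X * f = k - PowerSeries.rescale (1 - t) k) :
    (1 - z * t) * moment t u N k = PowerSeries.coeff 0 k + moment t u N f := by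
  have hc (n : ℕ) : PowerSeries.coeff n f
      = (1 - (1 - t) ^ (n + 1)) * PowerSeries.coeff (n + 1) k := by
    have := congrArg (PowerSeries.coeff (n + 1)) hf
    rw [PowerSeries.coeff_succ_X_mul, map_sub, PowerSeries.coeff_rescale] at this
    rw [this]; ring
  have h0 : qfac t (N + 1) = 0 := eq_zero_of_pow_dvd ht (Nat.lt_succ_self N) (pow_dvd_qfac t _)
  have hs : moment t u N f = ∑ n ∈ Finset.range (N + 1),
      u ^ (n + 1) * qfac t (n + 1) * PowerSeries.coeff (n + 1) k := by
    rw [moment_apply]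
    refine Finset.sum_congr rfl fun n _ => ?_
    rw [hc, qfac_succ]; ring
  have hk : (1 - z * t) * moment t u N k = ∑ n ∈ Finset.range (N + 1),
      u ^ n * qfac t n * PowerSeries.coeff n k := by
    rw [moment_apply, Finset.mul_sum]
    refine Finset.sum_congr rfl fun n _ => ?_
    linear_combination (u ^ n * qfac t n * PowerSeries.coeff n k) * hu
  rw [hk, hs, Finset.sum_range_succ', Finset.sum_range_succ _ N, h0, qfac_zero]
  ring

/-- The weighted number of continuations of an ascent sequence with `a` ascents and last
entry `l`. -/
noncomputable def contWeight (t u : Q) (N a l : ℕ) : Q :=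
  moment t u N (geom 1 ^ (a + 1) * ((1 - PowerSeries.X) * geom (1 - t)) ^ l)

lemma contWeight_zero_zero (t u : Q) (N : ℕ) :
    contWeight t u N 0 0 = ∑ n ∈ Finset.range (N + 1), u ^ (n + 1) * qfac t n := by
  simp [contWeight, moment_apply, geom]

/-- One more ascent multiplies by g = 1/(1-X), one more unit of last entry by r = (1-X)/(1-(1-t)X),
and r((1-t) + tg) = 1. The functional plays no role beyond linearity. -/
lemma contWeight_succ (t u : Q) (N a l : ℕ) :
    (1 - t) * contWeight t u N a (l + 1) + t * contWeight t u N (a + 1) (l + 1)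
      = contWeight t u N a l := by
  have h1 : geom (1 : Q) * (1 - PowerSeries.X) = 1 := by simpa using geom_mul (1 : Q)
  have h2 := geom_mul (1 - t)
  simp only [contWeight]
  rw [mul_moment, mul_moment, ← map_add]
  congr 1
  rw [map_sub, map_one] at *
  generalize geom (1 : Q) = g at *
  generalize geom (1 - t) = h at *
  have e : g ^ (a + 1 + 1) * ((1 - PowerSeries.X) * h) ^ (l + 1)
      = g ^ (a + 1) * ((1 - PowerSeries.X) * h) ^ l * h := by
    linear_combination (g ^ (a + 1) * ((1 - PowerSeries.X) * h) ^ l * h) * h1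
  rw [e]
  linear_combination (g ^ (a + 1) * ((1 - PowerSeries.X) * h) ^ l) * h2

/-- The geometric sum in r closes up: with h = 1/(1-(1-t)X), gr = h and 1-r = tXh, so X times the
sum is g^(a+1) - h^(a+1), and h is g rescaled by 1-t. This is the input of `moment_spec`. -/
lemma contWeight_zero {t z u : Q} {N : ℕ} (ht : t ^ (N + 1) = 0) (hu : (1 - z * t) * u = 1)
    (a : ℕ) : contWeight t u N a 0
      = 1 + t * (z * contWeight t u N a 0
        + ∑ l ∈ Finset.range (a + 1), contWeight t u N (a + 1) (l + 1)) := by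
  have h1 : geom (1 : Q) * (1 - PowerSeries.X) = 1 := by simpa using geom_mul (1 : Q)
  have h2 := geom_mul (1 - t)
  have key := moment_spec ht hu (k := geom 1 ^ (a + 1))
    (f := PowerSeries.C t * ∑ l ∈ Finset.range (a + 1),
      geom 1 ^ (a + 1 + 1) * ((1 - PowerSeries.X) * geom (1 - t)) ^ (l + 1)) (by
    rw [map_pow, rescale_geom_one]
    rw [map_sub, map_one] at h2
    generalize geom (1 : Q) = g at *
    generalize geom (1 - t) = h at *
    have hg := mul_neg_geom_sum ((1 - PowerSeries.X) * h) (a + 1)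
    have e (l : ℕ) : g ^ (a + 1 + 1) * ((1 - PowerSeries.X) * h) ^ (l + 1)
        = g ^ (a + 1) * h * ((1 - PowerSeries.X) * h) ^ l := by
      linear_combination (g ^ (a + 1) * ((1 - PowerSeries.X) * h) ^ l * h) * h1
    simp only [e]
    rw [← Finset.mul_sum]
    generalize ∑ i ∈ Finset.range (a + 1), ((1 - PowerSeries.X) * h) ^ i = S at *
    have hp : (g * ((1 - PowerSeries.X) * h)) ^ (a + 1) = h ^ (a + 1) := by
      congr 1
      linear_combination h * h1
    rw [mul_pow] at hp
    linear_combination g ^ (a + 1) * hg - hp + g ^ (a + 1) * S * h2)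
  have h0 : PowerSeries.coeff 0 (geom (1 : Q) ^ (a + 1)) = 1 := by
    simp [geom, PowerSeries.coeff_zero_eq_constantCoeff_apply]
  rw [h0, ← PowerSeries.smul_eq_C_mul, map_smul, map_sum, smul_eq_mul] at key
  simp only [contWeight, pow_zero, mul_one] at *
  linear_combination key

/-- The recursion that expresses the last-entry step of ascent sequences. -/
lemma contWeight_rec {t z u : Q} {N : ℕ} (ht : t ^ (N + 1) = 0) (hu : (1 - z * t) * u = 1)
    (a : ℕ) {l : ℕ} (hl : l ≤ a + 1) : contWeight t u N a l
      = 1 + t * (z * contWeight t u N a 0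
        + ∑ i ∈ Finset.range l, contWeight t u N a (i + 1)
        + ∑ i ∈ Finset.Ico l (a + 1), contWeight t u N (a + 1) (i + 1)) := by
  induction l with
  | zero => simpa using contWeight_zero ht hu a
  | succ l ih =>
    have h := ih (by omega)
    -- Raising the last entry to l+1 turns the appended value l+1 from an ascent into a non-ascent;
    -- `contWeight_succ` accounts for exactly this exchange.
    rw [Finset.sum_eq_sum_Ico_succ_bot (by omega)] at h
    rw [Finset.sum_range_succ]
    linear_combination h + contWeight_succ t u N a l

end Algebra

/-! ### Ascent sequences and their generating function -/

section Ascent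

lemma asc_append_singleton (x : List ℕ) (hx : x ≠ []) (v : ℕ) :
    asc (x ++ [v]) = asc x + if x.getLast hx < v then 1 else 0 := by
  induction x with
  | nil => exact absurd rfl hx
  | cons a x ih =>
    cases x with
    | nil => by_cases h : a < v <;> simp [asc, h]
    | cons b x =>
      have := ih (by simp)
      simp only [asc, List.cons_append, List.tail_cons, List.zip_cons_cons, List.countP_cons,
        List.getLast_cons_cons] at this ⊢
      rw [this]
      by_cases hv : (b :: x).getLast (by simp) < v <;> simp [hv] <;> omega

/-- The largest entry that may follow the ascent sequence `x`. -/
def nextBound : List ℕ → ℕ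
  | [] => 0
  | a :: x => 1 + asc (a :: x)

lemma nextBound_of_ne_nil {x : List ℕ} (hx : x ≠ []) : nextBound x = 1 + asc x := by
  cases x with
  | nil => exact absurd rfl hx
  | cons a x => rfl

lemma isAscentSeq_append_singleton (x : List ℕ) (v : ℕ) :
    IsAscentSeq (x ++ [v]) ↔ IsAscentSeq x ∧ v ≤ nextBound x := by
  rcases eq_or_ne x [] with rfl | hx
  · simp [IsAscentSeq, nextBound]
  · have hp : 0 < x.length := List.length_pos_iff.2 hx
    rw [nextBound_of_ne_nil hx]
    constructor
    · rintro ⟨h0, h⟩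
      refine ⟨⟨fun _ => ?_, fun i hi hi0 => ?_⟩, ?_⟩
      · simpa [List.getElem_append_left hp] using h0 (by simp)
      · have := h i (by simp; omega) hi0
        rwa [List.getElem_append_left hi, List.take_append_of_le_length hi.le] at this
      · simpa using h x.length (by simp) hp
    · rintro ⟨⟨h0, h⟩, hv⟩
      refine ⟨fun _ => ?_, fun i hi hi0 => ?_⟩
      · rw [List.getElem_append_left hp]; exact h0 hp
      · rcases lt_or_ge i x.length with hi' | hi'
        · rw [List.getElem_append_left hi', List.take_append_of_le_length hi'.le]
          exact h i hi' hi0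
        · obtain rfl : i = x.length := by simp at hi; omega
          simpa using hv

/-- The ascent sequences of length `n`. -/
def ascentSeqs : ℕ → Finset (List ℕ)
  | 0 => {[]}
  | n + 1 => ((ascentSeqs n).sigma fun x => Finset.range (nextBound x + 1)).image
      fun p => p.1 ++ [p.2]

lemma mem_ascentSeqs {n : ℕ} {x : List ℕ} :
    x ∈ ascentSeqs n ↔ IsAscentSeq x ∧ x.length = n := by
  induction n generalizing x with
  | zero =>
    simp only [ascentSeqs, Finset.mem_singleton, List.length_eq_zero_iff]
    constructor
    · rintro rfl; simp [IsAscentSeq]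
    · exact fun h => h.2
  | succ n ih =>
    simp only [ascentSeqs, Finset.mem_image, Finset.mem_sigma, Finset.mem_range, ih, Sigma.exists]
    constructor
    · rintro ⟨y, v, ⟨⟨hy, rfl⟩, hv⟩, rfl⟩
      exact ⟨(isAscentSeq_append_singleton y v).2 ⟨hy, by omega⟩, by simp⟩
    · rintro ⟨hx, hl⟩
      obtain ⟨y, v, rfl⟩ := List.eq_nil_or_concat' x |>.resolve_left (by rintro rfl; simp at hl)
      obtain ⟨h1, h2⟩ := (isAscentSeq_append_singleton y v).1 hx
      exact ⟨y, v, ⟨⟨h1, by simpa using hl⟩, by omega⟩, rfl⟩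

lemma sum_ascentSeqs_succ {Q : Type*} [AddCommMonoid Q] (n : ℕ) (f : List ℕ → Q) :
    ∑ x ∈ ascentSeqs (n + 1), f x
      = ∑ x ∈ ascentSeqs n, ∑ v ∈ Finset.range (nextBound x + 1), f (x ++ [v]) := by
  rw [ascentSeqs, Finset.sum_image, Finset.sum_sigma]
  rintro ⟨x, v⟩ _ ⟨y, w⟩ _ h
  obtain ⟨rfl, h⟩ := List.append_inj' h rfl
  simpa using h

/-- An entry exceeding its predecessor pays for itself with a new ascent. The bound supplies the
range condition of `contWeight_rec`. -/
lemma IsAscentSeq.getLast_le_asc {x : List ℕ} (h : IsAscentSeq x) (hx : x ≠ []) :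
    x.getLast hx ≤ asc x := by
  induction x using List.reverseRecOn with
  | nil => exact absurd rfl hx
  | append_singleton x v ih =>
    obtain ⟨h1, h2⟩ := (isAscentSeq_append_singleton x v).1 h
    rw [List.getLast_append_singleton]
    rcases eq_or_ne x [] with rfl | hx'
    · simp [nextBound] at h2; omega
    · rw [asc_append_singleton x hx']
      rw [nextBound_of_ne_nil hx'] at h2
      have := ih h1 hx'
      split_ifs <;> omega

variable {Q : Type*} [CommRing Q]

/-- The weighted number of continuations of an ascent sequence. -/
noncomputable def stateWeight (t u : Q) (N : ℕ) (x : List ℕ) : Q :=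
  contWeight t u N (asc x) (x.getLastD 0)

lemma stateWeight_rec {t z u : Q} {N : ℕ} (ht : t ^ (N + 1) = 0) (hu : (1 - z * t) * u = 1)
    {x : List ℕ} (h : IsAscentSeq x) (hx : x ≠ []) :
    t ^ x.length * z ^ x.count 0 * stateWeight t u N x = t ^ x.length * z ^ x.count 0
      + ∑ v ∈ Finset.range (nextBound x + 1),
        t ^ (x ++ [v]).length * z ^ (x ++ [v]).count 0 * stateWeight t u N (x ++ [v]) := by
  have hl := h.getLast_le_asc hx
  have hlast : x.getLastD 0 = x.getLast hx := by
    rw [List.getLastD_eq_getLast?, List.getLast?_eq_getLast_of_ne_nil hx]; rfl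
  have hrec := contWeight_rec ht hu (asc x) (l := x.getLast hx) (by omega)
  have hzero : stateWeight t u N (x ++ [0]) = contWeight t u N (asc x) 0 := by
    simp [stateWeight, asc_append_singleton x hx]
  have hsucc (v : ℕ) : stateWeight t u N (x ++ [v + 1])
      = if v < x.getLast hx then contWeight t u N (asc x) (v + 1)
        else contWeight t u N (asc x + 1) (v + 1) := by
    rw [stateWeight, asc_append_singleton x hx]
    by_cases hv : v < x.getLast hx
    · simp [hv, show ¬ x.getLast hx < v + 1 by omega]
    · simp [hv, show x.getLast hx < v + 1 by omega]
  -- The appended value is 0 (factor z), positive but at most the last entry (no ascent), or larger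
  -- (one ascent).
  rw [nextBound_of_ne_nil hx, Finset.sum_range_succ', hzero,
    ← Finset.sum_range_add_sum_Ico _ (show x.getLast hx ≤ 1 + asc x by omega)]
  rw [Finset.sum_congr rfl (g := fun i => t ^ x.length * z ^ x.count 0 * t *
      contWeight t u N (asc x) (i + 1)) (fun v hv => ?_),
    Finset.sum_congr (s₁ := Finset.Ico _ _) rfl (g := fun i => t ^ x.length * z ^ x.count 0 * t *
      contWeight t u N (asc x + 1) (i + 1)) (fun v hv => ?_), ← Finset.mul_sum, ← Finset.mul_sum]
  · rw [stateWeight, hlast, add_comm 1 (asc x)]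
    simp only [List.length_append, List.count_append, List.length_singleton,
      List.count_singleton_self, pow_add, pow_one]
    linear_combination (t ^ x.length * z ^ x.count 0) * hrec
  · rw [hsucc, if_neg (by simp at hv; omega)]
    simp [pow_add, List.count_append]; ring
  · rw [hsucc, if_pos (by simpa using hv)]
    simp [pow_add, List.count_append]; ring

/-- The recursion unrolled n times from the sequence (0). The remainder sits on length n+1, so it
vanishes at n = N. -/
lemma sum_ascentSeqs_stateWeight {t z u : Q} {N : ℕ} (ht : t ^ (N + 1) = 0)
    (hu : (1 - z * t) * u = 1) (n : ℕ) :
    ∑ i ∈ Finset.range n, ∑ x ∈ ascentSeqs (i + 1), t ^ x.length * z ^ x.count 0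
      + ∑ x ∈ ascentSeqs (n + 1), t ^ x.length * z ^ x.count 0 * stateWeight t u N x
      = z * t * contWeight t u N 0 0 := by
  induction n with
  | zero =>
    rw [sum_ascentSeqs_succ]
    simp [ascentSeqs, nextBound, stateWeight, asc]
    ring
  | succ n ih =>
    rw [← ih, Finset.sum_range_succ, sum_ascentSeqs_succ (n + 1), add_assoc,
      ← Finset.sum_add_distrib]
    congr 1
    refine Finset.sum_congr rfl fun x hx => ?_
    obtain ⟨h1, h2⟩ := mem_ascentSeqs.1 hx
    rw [stateWeight_rec ht hu h1 (by rintro rfl; simp at h2)]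

lemma ascentCount_eq_card (n k : ℕ) :
    ascentCount n k = ((ascentSeqs n).filter fun x => x.count 0 = k).card := by
  rw [ascentCount, ← Nat.card_eq_finsetCard]
  refine Nat.card_congr (Equiv.subtypeEquivRight fun x => ?_)
  simp [mem_ascentSeqs, and_assoc]

/-- The generating function of ascent sequences, modulo `t ^ (N + 1)`. -/
theorem sum_ascentCount {t z u : Q} {N : ℕ} (ht : t ^ (N + 1) = 0) (hu : (1 - z * t) * u = 1) :
    ∑ n ∈ Finset.range (N + 1), ∑ k ∈ Finset.range (N + 1), (ascentCount n k : Q) * (t ^ n * z ^ k)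
      = 1 + ∑ n ∈ Finset.range (N + 1), z * t * u ^ (n + 1) * qfac t n := by
  have h1 (n : ℕ) (hn : n ∈ Finset.range (N + 1)) :
      ∑ k ∈ Finset.range (N + 1), (ascentCount n k : Q) * (t ^ n * z ^ k)
        = ∑ x ∈ ascentSeqs n, t ^ x.length * z ^ x.count 0 := by
    rw [← Finset.sum_fiberwise_of_maps_to (t := Finset.range (N + 1)) (g := fun x : List ℕ => x.count 0)]
    · refine Finset.sum_congr rfl fun k _ => ?_
      rw [ascentCount_eq_card, ← nsmul_eq_mul, ← Finset.sum_const]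
      refine Finset.sum_congr rfl fun x hx => ?_
      obtain ⟨hm, rfl⟩ := Finset.mem_filter.1 hx
      rw [(mem_ascentSeqs.1 hm).2]
    · intro x hx
      have h2 := (mem_ascentSeqs.1 hx).2
      have h3 := List.count_le_length (a := 0) (l := x)
      simp at hn ⊢; omega
  rw [Finset.sum_congr rfl h1, Finset.sum_range_succ', add_comm]
  congr 1
  · simp [ascentSeqs]
  · have h2 := sum_ascentSeqs_stateWeight ht hu N
    rw [Finset.sum_eq_zero (s := ascentSeqs (N + 1)), add_zero] at h2
    · rw [h2, contWeight_zero_zero, Finset.mul_sum]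
      exact Finset.sum_congr rfl fun _ _ => by ring
    · intro x hx
      rw [(mem_ascentSeqs.1 hx).2, ht]; ring

end Ascent

/-! ### Canonical intervals of a (2+2)-free poset -/

section Poset

lemma twoPlusTwoFree_iff {α : Type*} [PartialOrder α] :
    TwoPlusTwoFree α ↔ ∀ a b c d : α, a < b → c < d → a < d ∨ c < b := by
  constructor
  · intro h a b c d hab hcd
    by_contra! hn
    obtain ⟨had, hcb⟩ := hn
    have h1 : ¬ a ≤ c := fun h => had (h.trans_lt hcd)
    have h2 : ¬ a ≤ d := fun h => hcb (by
      rcases h.eq_or_lt with rfl | h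
      · exact hcd.trans hab
      · exact absurd h had)
    have h3 : ¬ b ≤ c := fun h => had (hab.trans_le (h.trans hcd.le))
    have h4 : ¬ b ≤ d := fun h => had (hab.trans_le h)
    have h5 : ¬ c ≤ a := fun h => hcb (h.trans_lt hab)
    have h6 : ¬ c ≤ b := fun h => had (by
      rcases h.eq_or_lt with rfl | h
      · exact hab.trans hcd
      · exact absurd h hcb)
    have h7 : ¬ d ≤ a := fun h => hcb (hcd.trans_le (h.trans hab.le))
    have h8 : ¬ d ≤ b := fun h => hcb (hcd.trans_le h)
    refine h.false (OrderEmbedding.ofMapLEIff (Sum.elim ![a, b] ![c, d]) ?_)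
    rintro (x | x) (y | y) <;> fin_cases x <;> fin_cases y <;>
      simp [hab.le, hcd.le, hab.not_ge, hcd.not_ge, h1, h2, h3, h4, h5, h6, h7, h8]
  · intro h
    refine ⟨fun f => ?_⟩
    have := h (f (.inl 0)) (f (.inl 1)) (f (.inr 0)) (f (.inr 1)) (by simp) (by simp)
    simp at this

variable {α : Type*} [Fintype α] [PartialOrder α]

variable (α) in
open Classical in
/-- The strict principal down-sets of a finite poset. -/
noncomputable def downs : Finset (Set α) := Finset.univ.image Set.Iio

open Classical in
/-- The number of strict down-sets properly contained in the one of `x`. -/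
noncomputable def level (x : α) : ℕ := ((downs α).filter (· ⊂ Set.Iio x)).card

open Classical in
/-- The largest level of an element which is not above `x`. -/
noncomputable def reach (x : α) : ℕ := ((downs α).filter (x ∉ ·)).card - 1

lemma mem_downs {c : Set α} : c ∈ downs α ↔ ∃ y, Set.Iio y = c := by simp [downs]

lemma Iio_mem_downs (x : α) : Set.Iio x ∈ downs α := mem_downs.2 ⟨x, rfl⟩

/-- If a < y but not a < w, then any c < w must lie below y, since otherwise a < y and c < w form a
2+2. -/
lemma downs_chain (h : TwoPlusTwoFree α) {c d : Set α} (hc : c ∈ downs α) (hd : d ∈ downs α) :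
    c ⊆ d ∨ d ⊂ c := by
  obtain ⟨y, rfl⟩ := mem_downs.1 hc
  obtain ⟨w, rfl⟩ := mem_downs.1 hd
  by_cases hs : Set.Iio y ⊆ Set.Iio w
  · exact Or.inl hs
  · obtain ⟨a, ha, ha'⟩ := Set.not_subset.1 hs
    refine Or.inr ⟨fun c hc => ?_, hs⟩
    exact (twoPlusTwoFree_iff.1 h a y c w ha hc).resolve_left ha'

lemma reach_add_one (x : α) :
    reach x + 1 = by classical exact ((downs α).filter (x ∉ ·)).card := by
  classical
  have : 0 < ((downs α).filter (x ∉ ·)).card :=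
    Finset.card_pos.2 ⟨Set.Iio x, by simp [Iio_mem_downs]⟩
  rw [reach]
  omega

/-- In the chain of down-sets those missing x form an initial segment with `reach x + 1` members,
and x < y means that `Set.Iio y` lies beyond it. -/
lemma lt_iff_reach_lt_level (h : TwoPlusTwoFree α) (x y : α) : x < y ↔ reach x < level y := by
  classical
  rw [← Nat.add_one_le_iff, reach_add_one, level]
  constructor
  · intro hxy
    refine Finset.card_le_card fun c hc => ?_
    obtain ⟨hc, hx⟩ := Finset.mem_filter.1 hc
    refine Finset.mem_filter.2 ⟨hc, ?_⟩
    exact (downs_chain h (Iio_mem_downs y) hc).resolve_left fun hs => hx (hs hxy)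
  · intro hle
    by_contra hxy
    refine absurd hle (not_le.2 (Finset.card_lt_card ?_))
    refine Finset.ssubset_iff_subset_ne.2 ⟨fun c hc => ?_, fun he => ?_⟩
    · obtain ⟨hc, hx⟩ := Finset.mem_filter.1 hc
      exact Finset.mem_filter.2 ⟨hc, fun hh => hxy (hx.1 hh)⟩
    · have : Set.Iio y ∈ (downs α).filter (x ∉ ·) :=
        Finset.mem_filter.2 ⟨Iio_mem_downs y, hxy⟩
      rw [← he] at this
      exact absurd (Finset.mem_filter.1 this).2 (ssubset_irrefl _)

lemma level_le_reach (h : TwoPlusTwoFree α) (x : α) : level x ≤ reach x :=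
  not_lt.1 fun hl => lt_irrefl x ((lt_iff_reach_lt_level h x x).2 hl)

lemma exists_rank (h : TwoPlusTwoFree α) {i : ℕ} (hi : i < (downs α).card) : by
    classical exact ∃ c ∈ downs α, ((downs α).filter (· ⊂ c)).card = i := by
  classical
  have hinj : Set.InjOn (fun c => ((downs α).filter (· ⊂ c)).card) (downs α : Set (Set α)) := by
    have hlt {c d : Set α} (hc : c ∈ downs α) (hcd : c ⊂ d) :
        ((downs α).filter (· ⊂ c)).card < ((downs α).filter (· ⊂ d)).card := by
      refine Finset.card_lt_card (Finset.ssubset_iff_subset_ne.2 ⟨fun e he => ?_, fun he => ?_⟩)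
      · obtain ⟨h1, h2⟩ := Finset.mem_filter.1 he
        exact Finset.mem_filter.2 ⟨h1, h2.trans hcd⟩
      · have : c ∈ (downs α).filter (· ⊂ d) := Finset.mem_filter.2 ⟨hc, hcd⟩
        rw [← he] at this
        exact absurd (Finset.mem_filter.1 this).2 (ssubset_irrefl _)
    intro c hc d hd hcd
    rcases downs_chain h hc hd with hs | hs
    · rcases hs.eq_or_ssubset with rfl | hs
      · rfl
      · exact absurd hcd (hlt hc hs).ne
    · exact absurd hcd (hlt hd hs).ne'
  have := Finset.surj_on_of_inj_on_of_card_le (s := downs α) (t := Finset.range (downs α).card)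
    (fun c _ => ((downs α).filter (· ⊂ c)).card) (fun c hc => ?_)
    (fun c d hc hd he => hinj hc hd he) (by simp) i (Finset.mem_range.2 hi)
  · obtain ⟨c, hc, he⟩ := this
    exact ⟨c, hc, he.symm⟩
  · refine Finset.mem_range.2 (Finset.card_lt_card (Finset.filter_ssubset.2 ⟨c, hc, ?_⟩))
    exact ssubset_irrefl _

lemma image_level (h : TwoPlusTwoFree α) :
    Finset.univ.image (level (α := α)) = Finset.range (downs α).card := by
  classical
  ext i
  simp only [Finset.mem_image, Finset.mem_univ, true_and, Finset.mem_range]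
  constructor
  · rintro ⟨x, rfl⟩
    exact Finset.card_lt_card (Finset.filter_ssubset.2
      ⟨Set.Iio x, Iio_mem_downs x, ssubset_irrefl _⟩)
  · intro hi
    obtain ⟨c, hc, rfl⟩ := exists_rank h hi
    obtain ⟨x, rfl⟩ := mem_downs.1 hc
    exact ⟨x, rfl⟩

lemma image_reach (h : TwoPlusTwoFree α) :
    Finset.univ.image (reach (α := α)) = Finset.range (downs α).card := by
  classical
  ext i
  simp only [Finset.mem_image, Finset.mem_univ, true_and, Finset.mem_range]
  constructor
  · rintro ⟨x, rfl⟩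
    rw [← Nat.add_one_le_iff, reach_add_one]
    exact Finset.card_filter_le _ _
  · intro hi
    suffices ∃ x : α, ((downs α).filter (x ∉ ·)).card = i + 1 by
      obtain ⟨x, hx⟩ := this
      exact ⟨x, by have := reach_add_one x; omega⟩
    rcases (Nat.succ_le_of_lt hi).eq_or_lt with hi' | hi'
    · obtain ⟨c, hc⟩ := Finset.card_pos.1 (Nat.zero_lt_of_lt hi)
      obtain ⟨y, -⟩ := mem_downs.1 hc
      -- The top value is reached by a maximal element, which belongs to no strict down-set.
      obtain ⟨x, -, hx⟩ := Finite.exists_le_maximal (p := fun _ : α => True) (a := y) trivial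
      refine ⟨x, ?_⟩
      rw [Finset.filter_true_of_mem, ← hi']
      intro c hc hxc
      obtain ⟨w, rfl⟩ := mem_downs.1 hc
      exact (show x < w from hxc).not_ge (hx.2 trivial (le_of_lt hxc))
    -- Otherwise take x in the difference of the consecutive down-sets of ranks i and i+1: the
    -- down-sets missing x are those strictly inside the larger one.
    · obtain ⟨c, hc, hci⟩ := exists_rank h hi
      obtain ⟨d, hd, hdi⟩ := exists_rank h hi'
      have hcd : c ⊂ d := by
        refine (downs_chain h hd hc).resolve_left fun hs => ?_
        have := Finset.card_le_card (s := (downs α).filter (· ⊂ d))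
          (t := (downs α).filter (· ⊂ c)) (Finset.monotone_filter_right _ fun e _ he =>
            lt_of_lt_of_le he hs)
        omega
      obtain ⟨x, hxd, hxc⟩ := Set.exists_of_ssubset hcd
      refine ⟨x, ?_⟩
      rw [← Nat.succ_eq_add_one, ← hdi]
      congr 1
      refine Finset.filter_congr fun e he => ⟨fun hx => ?_, fun hs hx => ?_⟩
      · exact (downs_chain h hd he).resolve_left fun hs => hx (hs hxd)
      · have hce : c ⊂ e := (downs_chain h he hc).resolve_left fun hs => hxc (hs hx)
        -- A down-set e with c ⊂ e ⊂ d would put two ranks between c and d.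
        have : (insert c ((downs α).filter (· ⊂ c))).card
            < ((downs α).filter (· ⊂ d)).card := by
          refine Finset.card_lt_card (Finset.ssubset_iff_subset_ne.2 ⟨fun b hb => ?_, fun hb => ?_⟩)
          · rcases Finset.mem_insert.1 hb with rfl | hb
            · exact Finset.mem_filter.2 ⟨hc, hcd⟩
            · exact Finset.mem_filter.2 ⟨(Finset.mem_filter.1 hb).1,
                (Finset.mem_filter.1 hb).2.trans hcd⟩
          · have h1 : e ∈ (downs α).filter (· ⊂ d) := Finset.mem_filter.2 ⟨he, hs⟩
            rw [← hb, Finset.mem_insert] at h1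
            rcases h1 with rfl | h1
            · exact ssubset_irrefl _ hce
            · exact ssubset_irrefl _ (hce.trans (Finset.mem_filter.1 h1).2)
        rw [Finset.card_insert_of_notMem (by simp), hci, hdi] at this
        omega

lemma level_eq_zero_iff (x : α) : level x = 0 ↔ IsMin x := by
  classical
  rw [level, Finset.card_eq_zero, Finset.filter_eq_empty_iff]
  constructor
  · intro hx y hy
    by_contra hxy
    have hlt : y < x := lt_of_le_not_ge hy hxy
    refine hx (Iio_mem_downs y) ⟨Set.Iio_subset_Iio hy, fun hs => ?_⟩
    exact lt_irrefl y (hs hlt)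
  · intro hx c _ hc
    obtain ⟨y, hy, -⟩ := Set.exists_of_ssubset hc
    exact hx.not_lt hy

variable (α) in
/-- The multiset of the intervals `[level x, reach x]`. -/
noncomputable def code : Multiset (ℕ × ℕ) :=
  Finset.univ.val.map fun x : α => (level x, reach x)

lemma card_code : Multiset.card (code α) = Fintype.card α := by simp [code]

lemma numMin_eq_countP : numMin α = (code α).countP (·.1 = 0) := by
  classical
  rw [code, Multiset.countP_map, numMin, Set.ncard_eq_toFinset_card']
  simp only [level_eq_zero_iff]
  rw [← Finset.filter_val, Finset.card_val]
  congr 1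
  ext x
  simp

/-- The multisets of intervals that arise as codes of posets with `m` levels. -/
structure IsCode (m : ℕ) (s : Multiset (ℕ × ℕ)) : Prop where
  le_of_mem : ∀ p ∈ s, p.1 ≤ p.2
  mem_fst : ∀ i, (∃ p ∈ s, p.1 = i) ↔ i < m
  mem_snd : ∀ j, (∃ p ∈ s, p.2 = j) ↔ j < m

lemma isCode_code (h : TwoPlusTwoFree α) : IsCode (downs α).card (code α) where
  le_of_mem p hp := by
    obtain ⟨x, -, rfl⟩ := Multiset.mem_map.1 hp
    exact level_le_reach h x
  mem_fst i := by
    have := Finset.ext_iff.1 (image_level h) i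
    simpa [code] using this
  mem_snd i := by
    have := Finset.ext_iff.1 (image_reach h) i
    simpa [code] using this

lemma code_congr {β : Type*} [Fintype β] [PartialOrder β] (e : α ≃o β) : code α = code β := by
  classical
  have hd : downs β = (downs α).image (Set.image e) := by
    ext c
    simp only [Finset.mem_image, mem_downs]
    constructor
    · rintro ⟨y, rfl⟩
      exact ⟨_, ⟨e.symm y, rfl⟩, by simp⟩
    · rintro ⟨_, ⟨x, rfl⟩, rfl⟩
      exact ⟨e x, by simp⟩
  have hi : Function.Injective (Set.image e) := Set.image_injective.2 e.injective
  have hl (x : α) : level (e x) = level x := by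
    rw [level, level, hd, Finset.filter_image, Finset.card_image_of_injective _ hi]
    congr 1
    refine Finset.filter_congr fun c _ => ?_
    rw [← e.image_Iio, ssubset_iff_subset_not_subset, ssubset_iff_subset_not_subset,
      Set.image_subset_image_iff e.injective, Set.image_subset_image_iff e.injective]
  have hr (x : α) : reach (e x) = reach x := by
    rw [reach, reach, hd, Finset.filter_image, Finset.card_image_of_injective _ hi]
    congr 2
    refine Finset.filter_congr fun c _ => ?_
    rw [e.injective.mem_set_image]
  rw [code, code, ← Multiset.map_univ_val_equiv e.toEquiv, Multiset.map_map]
  refine Multiset.map_congr rfl fun x _ => ?_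
  simp [hl, hr]

lemma exists_equiv_of_map_univ_eq {α β γ : Type*} [Fintype α] [Fintype β] {f : α → γ} {g : β → γ}
    (h : Finset.univ.val.map f = Finset.univ.val.map g) : ∃ e : α ≃ β, ∀ x, g (e x) = f x := by
  classical
  have hc (c : γ) : Nonempty ({x // f x = c} ≃ {y // g y = c}) := by
    have := congrArg (Multiset.countP (· = c)) h
    rw [Multiset.countP_map, Multiset.countP_map] at this
    refine ⟨Fintype.equivOfCardEq ?_⟩
    rw [Fintype.card_subtype, Fintype.card_subtype]
    simpa [Finset.card_def] using this
  let e (c : γ) := (hc c).some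
  refine ⟨(Equiv.sigmaFiberEquiv f).symm.trans
    ((Equiv.sigmaCongrRight e).trans (Equiv.sigmaFiberEquiv g)), fun x => ?_⟩
  exact (e (f x) ⟨x, rfl⟩).2

lemma nonempty_orderIso_of_code_eq {β : Type*} [Fintype β] [PartialOrder β]
    (hα : TwoPlusTwoFree α) (hβ : TwoPlusTwoFree β) (h : code α = code β) :
    Nonempty (α ≃o β) := by
  obtain ⟨e, he⟩ := exists_equiv_of_map_univ_eq h
  refine ⟨⟨e, fun {a b} => ?_⟩⟩
  rw [le_iff_lt_or_eq, le_iff_lt_or_eq, lt_iff_reach_lt_level hα, lt_iff_reach_lt_level hβ,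
    e.injective.eq_iff]
  have h1 := he a
  have h2 := he b
  simp only [Prod.mk.injEq] at h1 h2
  rw [h1.2, h2.1]

end Poset

/-! ### Posets from families of intervals -/

section Interval

variable {α : Type*} (f : α → ℕ × ℕ) (hf : ∀ x, (f x).1 ≤ (f x).2)

/-- The interval order of a family of intervals. -/
@[reducible] def intervalOrder : PartialOrder α where
  le x y := x = y ∨ (f x).2 < (f y).1
  le_refl x := Or.inl rfl
  le_trans x y w := by
    rintro (rfl | h1) (rfl | h2)
    · exact Or.inl rfl
    · exact Or.inr h2
    · exact Or.inr h1
    · exact Or.inr (h1.trans_le ((hf y).trans h2.le))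
  le_antisymm x y := by
    rintro (rfl | h1) (h2 | h2)
    · rfl
    · rfl
    · exact h2.symm
    · have := hf x; have := hf y; omega

lemma intervalOrder_lt_iff (x y : α) : (intervalOrder f hf).lt x y ↔ (f x).2 < (f y).1 := by
  let _ := intervalOrder f hf
  change x < y ↔ _
  rw [lt_iff_le_and_ne]
  constructor
  · rintro ⟨h | h, hn⟩
    · exact absurd h hn
    · exact h
  · intro h
    refine ⟨Or.inr h, ?_⟩
    rintro rfl
    have := hf x
    omega

lemma twoPlusTwoFree_intervalOrder : @TwoPlusTwoFree α (intervalOrder f hf) := by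
  let _ := intervalOrder f hf
  refine twoPlusTwoFree_iff.2 fun a b c d hab hcd => ?_
  have h := intervalOrder_lt_iff f hf
  rw [h] at hab hcd
  change (intervalOrder f hf).lt a d ∨ (intervalOrder f hf).lt c b
  rw [h, h]
  omega

/-- The strict down-set of y is E(i), the elements whose right end is below the left end i of y. All
left ends i < m occur, so these are all the down-sets; all right ends occur, so they are strictly
increasing. Hence the ranks are the original endpoints. -/
lemma code_intervalOrder [Fintype α] {m : ℕ} (hm : IsCode m (Finset.univ.val.map f)) :
    @code α _ (intervalOrder f hf) = Finset.univ.val.map f := by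
  classical
  let _ := intervalOrder f hf
  have hlt (x y : α) : x < y ↔ (f x).2 < (f y).1 := intervalOrder_lt_iff f hf x y
  have h1 (i : ℕ) : (∃ x, (f x).1 = i) ↔ i < m := by simpa using hm.mem_fst i
  have h2 (i : ℕ) : (∃ x, (f x).2 = i) ↔ i < m := by simpa using hm.mem_snd i
  obtain ⟨E, mem_E⟩ : ∃ E : ℕ → Set α, ∀ i x, x ∈ E i ↔ (f x).2 < i :=
    ⟨fun i => {x | (f x).2 < i}, fun _ _ => Iff.rfl⟩
  have hE (y : α) : Set.Iio y = E (f y).1 := by ext x; rw [mem_E]; exact hlt x y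
  have hmono {i j : ℕ} (h : i ≤ j) : E i ⊆ E j := fun x hx =>
    (mem_E j x).2 (((mem_E i x).1 hx).trans_le h)
  have hstrict {i j : ℕ} (h : i < j) (hj : j < m) : E i ⊂ E j := by
    refine ⟨hmono h.le, fun hs => ?_⟩
    obtain ⟨x, hx⟩ := (h2 i).2 (h.trans hj)
    have := (mem_E i x).1 (hs ((mem_E j x).2 (by omega)))
    omega
  have hss {i j : ℕ} (hi : i < m) (hj : j < m) : E i ⊂ E j ↔ i < j := by
    refine ⟨fun h => ?_, fun h => hstrict h hj⟩
    by_contra hn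
    exact h.2 (hmono (not_lt.1 hn))
  have hinj : Set.InjOn E (Finset.range m : Set ℕ) := by
    intro i hi j hj hij
    simp only [Finset.coe_range, Set.mem_Iio] at hi hj
    rcases lt_trichotomy i j with h | h | h
    · exact absurd hij (hstrict h hj).ne
    · exact h
    · exact absurd hij (hstrict h hi).ne'
  have hd : downs α = (Finset.range m).image E := by
    ext c
    simp only [mem_downs, Finset.mem_image, Finset.mem_range]
    constructor
    · rintro ⟨y, rfl⟩
      exact ⟨_, (h1 _).1 ⟨y, rfl⟩, (hE y).symm⟩
    · rintro ⟨i, hi, rfl⟩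
      obtain ⟨y, rfl⟩ := (h1 i).2 hi
      exact ⟨y, hE y⟩
  have hl (x : α) : level x = (f x).1 := by
    have hx := (h1 _).1 ⟨x, rfl⟩
    rw [level, hd, Finset.filter_image, Finset.card_image_of_injOn
      (hinj.mono (Finset.coe_subset.2 (Finset.filter_subset _ _))), hE]
    convert Finset.card_range (f x).1 using 2
    ext i
    simp only [Finset.mem_filter, Finset.mem_range]
    constructor
    · rintro ⟨hi, h⟩; exact (hss hi hx).1 h
    · intro h; exact ⟨h.trans hx, (hss (h.trans hx) hx).2 h⟩
  have hr (x : α) : reach x = (f x).2 := by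
    have hx := (h2 _).1 ⟨x, rfl⟩
    have hr := reach_add_one x
    rw [hd, Finset.filter_image, Finset.card_image_of_injOn
      (hinj.mono (Finset.coe_subset.2 (Finset.filter_subset _ _)))] at hr
    refine Nat.succ_injective (hr.trans ?_)
    convert Finset.card_range ((f x).2 + 1) using 2
    ext i
    simp only [Finset.mem_filter, Finset.mem_range, mem_E]
    omega
  rw [code]
  refine Multiset.map_congr rfl fun x _ => ?_
  rw [hl, hr]

end Interval

lemma exists_map_univ_eq {γ : Type*} {n : ℕ} {s : Multiset γ} (h : Multiset.card s = n) :
    ∃ f : Fin n → γ, Finset.univ.val.map f = s := by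
  obtain ⟨l, rfl⟩ : ∃ l : List γ, (l : Multiset γ) = s := ⟨s.toList, s.coe_toList⟩
  rw [Multiset.coe_card] at h
  subst h
  refine ⟨l.get, ?_⟩
  rw [Fin.univ_val_map, List.ofFn_get]

/-- Isomorphism classes of `(2+2)`-free posets correspond to codes. -/
theorem posetCount_eq_card (n k : ℕ) : posetCount n k =
    Nat.card {s : Multiset (ℕ × ℕ) // (∃ m, IsCode m s) ∧ Multiset.card s = n ∧
      s.countP (·.1 = 0) = k} := by
  rw [posetCount]
  refine Nat.card_congr (Equiv.ofBijective (Quotient.lift (fun P : LabeledPoset n k =>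
    ⟨@code (Fin n) _ P.1, ⟨_, @isCode_code _ _ P.1 P.2.1⟩, ?_, ?_⟩) ?_) ⟨?_, ?_⟩)
  · exact (@card_code _ _ P.1).trans (Fintype.card_fin n)
  · exact (@numMin_eq_countP _ _ P.1).symm.trans P.2.2
  · rintro P R ⟨e⟩
    exact Subtype.ext (@code_congr _ _ P.1 _ _ R.1 e)
  · rintro ⟨P⟩ ⟨R⟩ h
    exact Quotient.sound (@nonempty_orderIso_of_code_eq _ _ P.1 _ _ R.1 P.2.1 R.2.1
      (congrArg Subtype.val h))
  · rintro ⟨s, ⟨m, hm⟩, hn, hk⟩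
    obtain ⟨f, rfl⟩ := exists_map_univ_eq hn
    have hf (x : Fin n) : (f x).1 ≤ (f x).2 := hm.le_of_mem _ (by simp)
    have hc := code_intervalOrder f hf hm
    refine ⟨Quotient.mk _ ⟨intervalOrder f hf, twoPlusTwoFree_intervalOrder f hf, ?_⟩,
      Subtype.ext hc⟩
    rw [@numMin_eq_countP _ _ (intervalOrder f hf), hc, hk]

/-! ### The functional equation for signed matrix sums -/

section AltSum

variable {Q : Type*} [CommRing Q]

/-- The signed sum, over all sets of rows, of the weights of triangular matrices without zero
columns in which these rows vanish; `y i` is the weight of an entry in row `i`, and `A` is the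
weight of the part of a column above the matrix. -/
def altSum (A : Q) {m : ℕ} (y : Fin m → Q) : Q :=
  ∑ S : Fin m → Bool, (∏ i, if S i = true then (-1 : Q) else 1) *
    ∏ j, (A * ∏ i, (if i ≤ j ∧ S i = false then y i else 1) - 1)

lemma altSum_zero (A : Q) (y : Fin 0 → Q) : altSum A y = 1 := by simp [altSum]

/-- Column 0 meets only row 0. Keeping row 0 gives that column the factor A y₀ - 1 and turns A into
A y₀ for the others; forcing row 0 to vanish costs a sign and leaves A - 1 and A. -/
lemma altSum_succ (A : Q) {m : ℕ} (y : Fin (m + 1) → Q) :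
    altSum A y = (A * y 0 - 1) * altSum (A * y 0) (fun i => y i.succ)
      - (A - 1) * altSum A (fun i => y i.succ) := by
  rw [altSum, ← (Fin.consEquiv fun _ => Bool).sum_comp, Fintype.sum_prod_type, Fintype.sum_bool]
  have h0 (i : Fin m) : ¬ i.succ ≤ 0 := by simp
  simp only [Fin.consEquiv_apply, Fin.prod_univ_succ, Fin.cons_zero, Fin.cons_succ, h0,
    Fin.succ_le_succ_iff, Fin.zero_le, true_and, false_and, if_false, if_true,
    Finset.prod_const_one, mul_one, one_mul, Bool.true_eq_false, Bool.false_eq_true]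
  rw [altSum, altSum, Finset.mul_sum, Finset.mul_sum, sub_eq_add_neg _ (Finset.sum _ _),
    ← Finset.sum_neg_distrib, add_comm]
  congr 1
  · refine Finset.sum_congr rfl fun S _ => ?_
    simp only [mul_assoc]
    ring
  · exact Finset.sum_congr rfl fun S _ => by ring

lemma dvd_mul_sub_one {t A v : Q} (hA : t ∣ A - 1) (hv : t ∣ v - 1) : t ∣ A * v - 1 := by
  have : A * v - 1 = (A - 1) * v + (v - 1) := by ring
  rw [this]
  exact (hA.mul_right v).add hv

/-- Each removed row yields a factor divisible by t. This kills the boundary terms when the sum over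
sizes is truncated. -/
lemma pow_dvd_altSum {t v : Q} (hv : t ∣ v - 1) (m : ℕ) {A : Q} (hA : t ∣ A - 1) :
    t ^ m ∣ altSum A (fun _ : Fin m => v) := by
  induction m generalizing A with
  | zero => simp
  | succ m ih =>
    rw [altSum_succ, pow_succ']
    exact (mul_dvd_mul (dvd_mul_sub_one hA hv) (ih (dvd_mul_sub_one hA hv))).sub
      (mul_dvd_mul hA (ih hA))

lemma sum_altSum_rec {t v : Q} {N : ℕ} (ht : t ^ (N + 1) = 0) (hv : t ∣ v - 1) {A : Q}
    (hA : t ∣ A - 1) :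
    A * ∑ m ∈ Finset.range (N + 1), altSum A (fun _ : Fin m => v)
      = 1 + (A * v - 1) * ∑ m ∈ Finset.range (N + 1), altSum (A * v) (fun _ : Fin m => v) := by
  have vanish {B : Q} (hB : t ∣ B - 1) : (B - 1) * altSum B (fun _ : Fin N => v) = 0 :=
    eq_zero_of_pow_dvd ht (Nat.lt_succ_self N)
      (by rw [pow_succ']; exact mul_dvd_mul hB (pow_dvd_altSum hv N hB))
  have h1 := vanish hA
  have h2 := vanish (dvd_mul_sub_one hA hv)
  have h3 : ∑ m ∈ Finset.range (N + 1), altSum A (fun _ : Fin m => v)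
      = 1 + ((A * v - 1) * ∑ m ∈ Finset.range N, altSum (A * v) (fun _ : Fin m => v)
        - (A - 1) * ∑ m ∈ Finset.range N, altSum A (fun _ : Fin m => v)) := by
    rw [Finset.sum_range_succ', altSum_zero, add_comm, Finset.mul_sum, Finset.mul_sum,
      ← Finset.sum_sub_distrib]
    congr 1
    exact Finset.sum_congr rfl fun m _ => altSum_succ _ _
  rw [Finset.sum_range_succ] at h3 ⊢
  rw [Finset.sum_range_succ]
  linear_combination h3 + h1 - h2

/-- Write A^(n+1) = (Av)^(n+1) (1-t)^(n+1) and use (1-t)^(n+1) `qfac t n` = `qfac t n` - `qfac t (n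
+ 1)`. -/
lemma sum_qfac_rec {t v : Q} {N : ℕ} (ht : t ^ (N + 1) = 0) (hv : (1 - t) * v = 1) (A : Q) :
    A * ∑ n ∈ Finset.range (N + 1), A ^ n * qfac t n
      = 1 + (A * v - 1) * ∑ n ∈ Finset.range (N + 1), (A * v) ^ n * qfac t n := by
  have h0 : qfac t (N + 1) = 0 := eq_zero_of_pow_dvd ht (Nat.lt_succ_self N) (pow_dvd_qfac t _)
  have h1 : A * ∑ n ∈ Finset.range (N + 1), A ^ n * qfac t n
      = ∑ n ∈ Finset.range (N + 1), ((A * v) ^ (n + 1) * qfac t n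
        - (A * v) ^ (n + 1) * qfac t (n + 1)) := by
    rw [Finset.mul_sum]
    refine Finset.sum_congr rfl fun n _ => ?_
    have h2 : ((1 - t) * v) ^ (n + 1) = 1 := by rw [hv, one_pow]
    rw [mul_pow] at h2
    rw [qfac_succ, mul_pow]
    linear_combination (- A ^ (n + 1) * qfac t n) * h2
  have h3 : ∑ n ∈ Finset.range (N + 1), (A * v) ^ (n + 1) * qfac t (n + 1)
      = ∑ n ∈ Finset.range (N + 1), (A * v) ^ n * qfac t n - 1 := by
    have := Finset.sum_range_succ' (fun n => (A * v) ^ n * qfac t n) (N + 1)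
    rw [Finset.sum_range_succ _ (N + 1), h0, qfac_zero] at this
    linear_combination - this
  rw [h1, Finset.sum_sub_distrib, h3, sub_mul, Finset.mul_sum]
  simp only [pow_succ', mul_assoc]
  ring

lemma sum_altSum_eq {t v : Q} {N : ℕ} (ht : t ^ (N + 1) = 0) (hv : (1 - t) * v = 1) {A : Q}
    (hA : t ∣ A - 1) :
    ∑ m ∈ Finset.range (N + 1), altSum A (fun _ : Fin m => v)
      = ∑ n ∈ Finset.range (N + 1), A ^ n * qfac t n := by
  have hv' : t ∣ v - 1 := ⟨v, by linear_combination hv⟩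
  rw [← sub_eq_zero]
  -- The difference D of the two sides satisfies A D(A) = (Av-1) D(Av) with A a unit, so each
  -- application gains a factor t.
  suffices ∀ (k : ℕ) (A : Q), t ∣ A - 1 → t ^ k ∣
      ∑ m ∈ Finset.range (N + 1), altSum A (fun _ : Fin m => v)
        - ∑ n ∈ Finset.range (N + 1), A ^ n * qfac t n from
    eq_zero_of_pow_dvd ht (Nat.lt_succ_self N) (this (N + 1) A hA)
  intro k
  induction k with
  | zero => simp
  | succ k ih =>
    intro A hA
    have hunit : IsUnit A := by
      have hn : IsNilpotent (A - 1) := by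
        obtain ⟨c, hc⟩ := hA
        exact ⟨N + 1, by rw [hc, mul_pow, ht, zero_mul]⟩
      simpa using hn.isUnit_one_add
    have h1 := sum_altSum_rec ht hv' hA
    have h2 := sum_qfac_rec ht hv A
    have hAv := dvd_mul_sub_one hA hv'
    rw [← hunit.dvd_mul_left, mul_sub, h1, h2, add_sub_add_left_eq_sub, ← mul_sub, pow_succ']
    exact mul_dvd_mul hAv (ih _ hAv)

end AltSum

/-! ### Inclusion-exclusion for triangular matrices -/

section Matrices

variable {Q : Type*} [CommRing Q]

/-- The upper triangular matrices with entries at most `N`, as functions of the column and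
the row. -/
def triMats (N m : ℕ) : Finset (Fin m → Fin m → ℕ) :=
  Fintype.piFinset fun j => Fintype.piFinset fun i =>
    if i ≤ j then Finset.range (N + 1) else {0}

lemma mem_triMats {N m : ℕ} {M : Fin m → Fin m → ℕ} :
    M ∈ triMats N m ↔ ∀ j i, M j i ≤ N ∧ (M j i ≠ 0 → i ≤ j) := by
  simp only [triMats, Fintype.mem_piFinset]
  refine forall₂_congr fun j i => ?_
  split_ifs with h
  · simp [h]
  · simp only [Finset.mem_singleton, h, imp_false, not_not]
    omega

/-- A matrix without zero rows and zero columns. -/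
def NoZeroLine {m : ℕ} (M : Fin m → Fin m → ℕ) : Prop :=
  (∀ i, ∃ j, M j i ≠ 0) ∧ ∀ j, ∃ i, M j i ≠ 0

instance {m : ℕ} (M : Fin m → Fin m → ℕ) : Decidable (NoZeroLine M) :=
  inferInstanceAs (Decidable (_ ∧ _))

lemma prod_one_sub_eq_sum {ι : Type*} [Fintype ι] [DecidableEq ι] (c : ι → Q) :
    ∏ i, (1 - c i) = ∑ S : ι → Bool, ∏ i, if S i = true then - c i else 1 := by
  have := Finset.prod_univ_sum (fun _ : ι => (Finset.univ : Finset Bool))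
    (fun i b => if b = true then - c i else 1)
  rw [Fintype.piFinset_univ] at this
  rw [← this]
  refine Finset.prod_congr rfl fun i _ => ?_
  rw [Fintype.sum_bool]
  simp
  ring

lemma prod_one_sub_indicator {ι : Type*} [Fintype ι] (p : ι → Prop) [DecidablePred p]
    [Decidable (∀ i, ¬ p i)] :
    ∏ i, (1 - if p i then (1 : Q) else 0) = if ∀ i, ¬ p i then 1 else 0 := by
  split_ifs with h
  · exact Finset.prod_eq_one fun i _ => by simp [h i]
  · obtain ⟨i, hi⟩ := not_forall_not.1 h
    exact Finset.prod_eq_zero (Finset.mem_univ i) (by simp [hi])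

lemma sum_nonzero_column {ι : Type*} [Fintype ι] [DecidableEq ι]
    [∀ v : ι → ℕ, Decidable (∀ i, v i = 0)] (r : ι → Finset ℕ)
    (hr : ∀ i, 0 ∈ r i) (g : ι → ℕ → Q) (hg : ∀ i, g i 0 = 1) :
    ∑ v ∈ Fintype.piFinset r, (1 - if ∀ i, v i = 0 then (1 : Q) else 0) * ∏ i, g i (v i)
      = ∏ i, ∑ k ∈ r i, g i k - 1 := by
  rw [Finset.prod_univ_sum]
  simp only [sub_mul, one_mul, Finset.sum_sub_distrib]
  congr 1
  rw [Finset.sum_eq_single (fun _ => 0)]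
  · simp [hg]
  · intro v _ hv
    rw [if_neg, zero_mul]
    exact fun h => hv (funext h)
  · intro h
    exact absurd (Fintype.mem_piFinset.2 hr) h

/-- Inclusion and exclusion over the zero rows. -/
lemma sum_triMats (N : ℕ) {m : ℕ} (x : Fin m → Q) :
    ∑ M ∈ (triMats N m).filter NoZeroLine, ∏ j, ∏ i, x i ^ M j i
      = altSum 1 (fun i => ∑ k ∈ Finset.range (N + 1), x i ^ k) := by
  have h1 (M : Fin m → Fin m → ℕ) :
      (if NoZeroLine M then ∏ j, ∏ i, x i ^ M j i else 0)
        = ∑ S : Fin m → Bool, (∏ i, if S i = true then (-1 : Q) else 1) *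
          ∏ j, ((1 - if ∀ i, M j i = 0 then (1 : Q) else 0) *
            ∏ i, (x i ^ M j i * if S i = true ∧ M j i ≠ 0 then 0 else 1)) := by
    have hrow : ∏ i, (1 - if ∀ j, M j i = 0 then (1 : Q) else 0)
        = if ∀ i, ∃ j, M j i ≠ 0 then 1 else 0 := by
      rw [prod_one_sub_indicator]; simp
    have hcol : ∏ j, (1 - if ∀ i, M j i = 0 then (1 : Q) else 0)
        = if ∀ j, ∃ i, M j i ≠ 0 then 1 else 0 := by
      rw [prod_one_sub_indicator]; simp
    have hind : (if NoZeroLine M then ∏ j, ∏ i, x i ^ M j i else 0)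
        = (∏ i, (1 - if ∀ j, M j i = 0 then (1 : Q) else 0)) *
          ((∏ j, (1 - if ∀ i, M j i = 0 then (1 : Q) else 0)) * ∏ j, ∏ i, x i ^ M j i) := by
      rw [hrow, hcol]
      by_cases ha : ∀ i, ∃ j, M j i ≠ 0 <;> by_cases hb : ∀ j, ∃ i, M j i ≠ 0 <;>
        simp only [NoZeroLine, ha, hb] <;> simp
    rw [hind, prod_one_sub_eq_sum, Finset.sum_mul]
    refine Finset.sum_congr rfl fun S _ => ?_
    have hS : (∏ i, if S i = true then - (if ∀ j, M j i = 0 then (1 : Q) else 0) else 1)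
        = (∏ i, if S i = true then (-1 : Q) else 1) *
          ∏ j, ∏ i, if S i = true ∧ M j i ≠ 0 then (0 : Q) else 1 := by
      rw [Finset.prod_comm, ← Finset.prod_mul_distrib]
      refine Finset.prod_congr rfl fun i _ => ?_
      by_cases hs : S i = true
      · by_cases h : ∀ j, M j i = 0
        · simp [hs, h]
        · obtain ⟨j, hj⟩ := not_forall.1 h
          rw [Finset.prod_eq_zero (Finset.mem_univ j) (by simp [hs, hj])]
          simp [h, hs]
      · simp [hs]
    rw [hS]
    simp only [Finset.prod_mul_distrib]
    ring
  rw [Finset.sum_filter, Finset.sum_congr rfl fun M _ => h1 M, Finset.sum_comm, altSum]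
  refine Finset.sum_congr rfl fun S _ => ?_
  rw [← Finset.mul_sum]
  congr 1
  rw [triMats, ← Finset.prod_univ_sum (fun j => Fintype.piFinset fun i =>
    if i ≤ j then Finset.range (N + 1) else {0}) (fun _ v =>
      (1 - if ∀ i, v i = 0 then (1 : Q) else 0) *
        ∏ i, (x i ^ v i * if S i = true ∧ v i ≠ 0 then 0 else 1))]
  refine Finset.prod_congr rfl fun j _ => ?_
  refine (sum_nonzero_column (fun i => if i ≤ j then Finset.range (N + 1) else {0})
    (fun i => by split_ifs <;> simp)
    (fun i k => x i ^ k * if S i = true ∧ k ≠ 0 then 0 else 1) (by simp)).trans ?_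
  rw [one_mul]
  congr 1
  refine Finset.prod_congr rfl fun i _ => ?_
  -- A kept row on or above the diagonal contributes its geometric sum; a row forced to vanish, or a
  -- place below the diagonal, contributes only the entry 0.
  by_cases hij : i ≤ j
  · cases hs : S i
    · simp [hij]
    · simp only [hij, if_true, true_and]
      rw [Finset.sum_range_succ']
      simp
  · simp [hij]

end Matrices

/-! ### Matrices as codes of posets -/

section MatrixCode

/-- The multiset of pairs (row, column) in which a pair occurs as often as the entry says. -/
def toCode {m : ℕ} (M : Fin m → Fin m → ℕ) : Multiset (ℕ × ℕ) :=
  ∑ j, ∑ i, Multiset.replicate (M j i) ((i : ℕ), (j : ℕ))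

lemma mem_toCode {m : ℕ} {M : Fin m → Fin m → ℕ} {p : ℕ × ℕ} :
    p ∈ toCode M ↔ ∃ j i, M j i ≠ 0 ∧ p = ((i : ℕ), (j : ℕ)) := by
  simp [toCode, Multiset.mem_sum, Multiset.mem_replicate]

lemma count_toCode {m : ℕ} (M : Fin m → Fin m → ℕ) (j i : Fin m) :
    (toCode M).count ((i : ℕ), (j : ℕ)) = M j i := by
  rw [toCode, Multiset.count_sum', Finset.sum_eq_single j, Multiset.count_sum',
    Finset.sum_eq_single i]
  · simp
  · intro b _ hb
    rw [Multiset.count_replicate, if_neg]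
    simpa [Fin.ext_iff] using hb
  · simp
  · intro b _ hb
    rw [Multiset.count_sum']
    refine Finset.sum_eq_zero fun a _ => ?_
    rw [Multiset.count_replicate, if_neg]
    simp only [Prod.mk.injEq, not_and]
    exact fun _ h => hb (Fin.ext h)
  · simp

lemma isCode_toCode {N m : ℕ} {M : Fin m → Fin m → ℕ} (hM : M ∈ triMats N m)
    (h : NoZeroLine M) : IsCode m (toCode M) where
  le_of_mem p hp := by
    obtain ⟨j, i, hij, rfl⟩ := mem_toCode.1 hp
    exact (mem_triMats.1 hM j i).2 hij
  mem_fst i := by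
    constructor
    · rintro ⟨p, hp, rfl⟩
      obtain ⟨j, i, -, rfl⟩ := mem_toCode.1 hp
      exact i.2
    · intro hi
      obtain ⟨j, hj⟩ := h.1 ⟨i, hi⟩
      exact ⟨_, mem_toCode.2 ⟨j, ⟨i, hi⟩, hj, rfl⟩, rfl⟩
  mem_snd j := by
    constructor
    · rintro ⟨p, hp, rfl⟩
      obtain ⟨j, i, -, rfl⟩ := mem_toCode.1 hp
      exact j.2
    · intro hj
      obtain ⟨i, hi⟩ := h.2 ⟨j, hj⟩
      exact ⟨_, mem_toCode.2 ⟨⟨j, hj⟩, i, hi, rfl⟩, rfl⟩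

lemma IsCode.le_card {m : ℕ} {s : Multiset (ℕ × ℕ)} (h : IsCode m s) : m ≤ Multiset.card s := by
  have h1 : Finset.range m ⊆ (s.map Prod.fst).toFinset := by
    intro i hi
    obtain ⟨p, hp, rfl⟩ := (h.mem_fst i).2 (Finset.mem_range.1 hi)
    simpa using ⟨_, hp⟩
  calc m = (Finset.range m).card := (Finset.card_range m).symm
    _ ≤ _ := Finset.card_le_card h1
    _ ≤ _ := Multiset.toFinset_card_le _
    _ = _ := Multiset.card_map _ _

lemma IsCode.unique {m m' : ℕ} {s : Multiset (ℕ × ℕ)} (h : IsCode m s) (h' : IsCode m' s) :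
    m = m' := by
  refine eq_of_forall_lt_iff fun i => ?_
  rw [← h.mem_fst, h'.mem_fst]

lemma IsCode.exists_toCode {N m : ℕ} {s : Multiset (ℕ × ℕ)} (h : IsCode m s)
    (hs : Multiset.card s ≤ N) :
    ∃ M : Fin m → Fin m → ℕ, M ∈ triMats N m ∧ NoZeroLine M ∧ toCode M = s := by
  refine ⟨fun j i => s.count ((i : ℕ), (j : ℕ)), ?_, ⟨fun i => ?_, fun j => ?_⟩, ?_⟩
  · refine mem_triMats.2 fun j i => ⟨(Multiset.count_le_card _ _).trans hs, fun hc => ?_⟩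
    exact h.le_of_mem _ (Multiset.count_ne_zero.1 hc)
  · obtain ⟨p, hp, hpi⟩ := (h.mem_fst i).2 i.2
    have hj := (h.mem_snd p.2).1 ⟨p, hp, rfl⟩
    exact ⟨⟨p.2, hj⟩, Multiset.count_ne_zero.2 (by rwa [← hpi])⟩
  · obtain ⟨p, hp, hpj⟩ := (h.mem_snd j).2 j.2
    have hi := (h.mem_fst p.1).1 ⟨p, hp, rfl⟩
    exact ⟨⟨p.1, hi⟩, Multiset.count_ne_zero.2 (by rwa [← hpj])⟩
  · ext ⟨a, b⟩
    by_cases hab : a < m ∧ b < m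
    · exact count_toCode _ ⟨b, hab.2⟩ ⟨a, hab.1⟩
    · rw [Multiset.count_eq_zero_of_notMem, Multiset.count_eq_zero_of_notMem]
      · exact fun hp => hab ⟨(h.mem_fst a).1 ⟨_, hp, rfl⟩, (h.mem_snd b).1 ⟨_, hp, rfl⟩⟩
      · intro hp
        obtain ⟨j, i, -, he⟩ := mem_toCode.1 hp
        obtain ⟨rfl, rfl⟩ := Prod.mk.inj he
        exact hab ⟨i.2, j.2⟩

/-- The matrices of size at most `N + 1` that encode posets. -/
def codeMats (N : ℕ) : Finset (Σ m : ℕ, Fin m → Fin m → ℕ) :=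
  (Finset.range (N + 2)).sigma fun m => (triMats N m).filter NoZeroLine

lemma posetCount_eq_card_filter {N n : ℕ} (hn : n ≤ N) (k : ℕ) :
    posetCount n k = ((codeMats N).filter fun p =>
      (Multiset.card (toCode p.2), (toCode p.2).countP (·.1 = 0)) = (n, k)).card := by
  rw [posetCount_eq_card, ← Nat.card_eq_finsetCard]
  symm
  have hmem (p : Σ m : ℕ, Fin m → Fin m → ℕ) : (p ∈ (codeMats N).filter fun p =>
      (Multiset.card (toCode p.2), (toCode p.2).countP (·.1 = 0)) = (n, k)) ↔
      (p.1 < N + 2 ∧ p.2 ∈ triMats N p.1 ∧ NoZeroLine p.2) ∧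
        Multiset.card (toCode p.2) = n ∧ (toCode p.2).countP (·.1 = 0) = k := by
    simp [codeMats]
  refine Nat.card_eq_of_bijective (fun p => ⟨toCode p.1.2, ?_, ?_⟩) ⟨?_, ?_⟩
  · obtain ⟨⟨-, h1, h2⟩, -⟩ := (hmem p.1).1 p.2
    exact ⟨_, isCode_toCode h1 h2⟩
  · exact ((hmem p.1).1 p.2).2
  · rintro ⟨⟨m, M⟩, hM⟩ ⟨⟨m', M'⟩, hM'⟩ he
    have he : toCode M = toCode M' := congrArg Subtype.val he
    obtain ⟨⟨-, h1, h2⟩, -⟩ := (hmem _).1 hM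
    obtain ⟨⟨-, h1', h2'⟩, -⟩ := (hmem _).1 hM'
    obtain rfl := (isCode_toCode h1 h2).unique (he ▸ isCode_toCode h1' h2')
    have : M = M' := by
      ext j i
      rw [← count_toCode M, he, count_toCode M']
    subst this
    rfl
  · rintro ⟨s, ⟨m, hm⟩, hs, hk⟩
    obtain ⟨M, h1, h2, rfl⟩ := hm.exists_toCode (N := N) (by omega)
    have := hm.le_card
    exact ⟨⟨⟨m, M⟩, (hmem _).2 ⟨⟨by dsimp only; omega, h1, h2⟩, hs, hk⟩⟩, rfl⟩

variable {Q : Type*} [CommRing Q]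

lemma prod_map_weight (t z : Q) (s : Multiset (ℕ × ℕ)) :
    (s.map fun p => if p.1 = 0 then z * t else t).prod
      = t ^ Multiset.card s * z ^ s.countP (·.1 = 0) := by
  induction s using Multiset.induction_on with
  | empty => simp
  | cons p s ih =>
    rw [Multiset.map_cons, Multiset.prod_cons, ih, Multiset.card_cons, Multiset.countP_cons]
    split_ifs <;> ring

lemma weight_toCode (t z : Q) {m : ℕ} (M : Fin m → Fin m → ℕ) :
    t ^ Multiset.card (toCode M) * z ^ (toCode M).countP (·.1 = 0)
      = ∏ j, ∏ i : Fin m, (if (i : ℕ) = 0 then z * t else t) ^ M j i := by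
  rw [← prod_map_weight, toCode, ← Multiset.coe_mapAddMonoidHom, map_sum, Multiset.prod_sum]
  refine Finset.prod_congr rfl fun j _ => ?_
  rw [map_sum, Multiset.prod_sum]
  refine Finset.prod_congr rfl fun i _ => ?_
  simp

lemma sum_codeMats {t z u : Q} {N : ℕ} (ht : t ^ (N + 1) = 0) (hu : (1 - z * t) * u = 1) :
    ∑ p ∈ codeMats N, t ^ Multiset.card (toCode p.2) * z ^ (toCode p.2).countP (·.1 = 0)
      = 1 + ∑ n ∈ Finset.range (N + 1), z * t * u ^ (n + 1) * qfac t n := by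
  have hgeom {c w : Q} (hc : c ^ (N + 1) = 0) (hw : (1 - c) * w = 1) :
      ∑ k ∈ Finset.range (N + 1), c ^ k = w := by
    have := mul_neg_geom_sum c (N + 1)
    rw [hc, sub_zero] at this
    calc _ = ((1 - c) * w) * ∑ k ∈ Finset.range (N + 1), c ^ k := by rw [hw, one_mul]
      _ = w * ((1 - c) * ∑ k ∈ Finset.range (N + 1), c ^ k) := by ring
      _ = w := by rw [this, mul_one]
  set v := ∑ k ∈ Finset.range (N + 1), t ^ k with hv
  have hv1 : (1 - t) * v = 1 := by rw [hv, mul_neg_geom_sum, ht, sub_zero]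
  have hu0 : ∑ k ∈ Finset.range (N + 1), (z * t) ^ k = u :=
    hgeom (by rw [mul_pow, ht, mul_zero]) hu
  rw [codeMats, Finset.sum_sigma]
  simp only [weight_toCode]
  simp_rw [sum_triMats]
  -- Size 0 is the empty poset. Removing row 0 from sizes 1 to N+1 leaves sizes 0 to N, the range in
  -- `sum_altSum_eq`.
  rw [Finset.sum_range_succ', altSum_zero, add_comm]
  congr 1
  have hstep (m : ℕ) : altSum 1 (fun i : Fin (m + 1) => ∑ k ∈ Finset.range (N + 1),
      (if (i : ℕ) = 0 then z * t else t) ^ k) = (u - 1) * altSum u (fun _ : Fin m => v) := by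
    rw [altSum_succ]
    simp [hu0, ← hv]
  simp_rw [hstep]
  -- Here u - 1 = ztu both provides t ∣ u - 1 and turns the prefactor into the required zt.
  rw [← Finset.mul_sum, sum_altSum_eq ht hv1 ⟨z * u, by linear_combination hu⟩, Finset.mul_sum]
  refine Finset.sum_congr rfl fun n _ => ?_
  linear_combination (u ^ n * qfac t n) * hu

/-- The generating function of `(2+2)`-free posets, modulo `t ^ (N + 1)`. -/
theorem sum_posetCount {t z u : Q} {N : ℕ} (ht : t ^ (N + 1) = 0) (hu : (1 - z * t) * u = 1) :
    ∑ n ∈ Finset.range (N + 1), ∑ k ∈ Finset.range (N + 1), (posetCount n k : Q) * (t ^ n * z ^ k)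
      = 1 + ∑ n ∈ Finset.range (N + 1), z * t * u ^ (n + 1) * qfac t n := by
  -- `codeMats N` also contains matrices with entry sum above N; their weight is zero.
  rw [← sum_codeMats ht hu, ← Finset.sum_product',
    ← Finset.sum_filter_of_ne (s := codeMats N) (p := fun p => Multiset.card (toCode p.2) ≤ N),
    ← Finset.sum_fiberwise_of_maps_to (s := (codeMats N).filter _) (t := Finset.range (N + 1) ×ˢ Finset.range (N + 1))
      (g := fun p => (Multiset.card (toCode p.2), (toCode p.2).countP (·.1 = 0)))]
  · refine Finset.sum_congr rfl fun ⟨n, k⟩ hnk => ?_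
    simp only [Finset.mem_product, Finset.mem_range] at hnk
    rw [posetCount_eq_card_filter (N := N) (by omega), ← nsmul_eq_mul, ← Finset.sum_const,
      Finset.filter_filter]
    refine Finset.sum_congr (Finset.filter_congr fun p _ => ?_) fun p hp => ?_
    · refine ⟨fun h => ⟨?_, h⟩, fun h => h.2⟩
      have := (Prod.mk.inj h).1
      omega
    · obtain ⟨h1, h2⟩ := Prod.mk.inj (Finset.mem_filter.1 hp).2.2
      rw [h1, h2]
  · intro p hp
    have h1 := (Finset.mem_filter.1 hp).2
    have h2 := Multiset.countP_le_card (fun q : ℕ × ℕ => q.1 = 0) (toCode p.2)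
    simp only [Finset.mem_product, Finset.mem_range]
    omega
  · intro p _ hp
    by_contra hN
    exact hp (by rw [pow_eq_zero_of_le (by omega) ht, zero_mul])

end MatrixCode

/-! ### Passage to formal power series -/

section PowerSeries

lemma one_sub_mul_inv : (1 - z * t) * MvPowerSeries.invOfUnit (1 - z * t) 1 = 1 :=
  MvPowerSeries.mul_invOfUnit _ _ (by simp [z, t])

lemma term_eq (n : ℕ) :
    term n = z * t * MvPowerSeries.invOfUnit (1 - z * t) 1 ^ (n + 1) * qfac t n := rfl

/-- Each of the n factors of the product is divisible by t; this makes the series converge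
coefficientwise. -/
lemma coeff_term_eq_zero {n : ℕ} {d : Fin 2 →₀ ℕ} (h : d 0 < n) :
    MvPowerSeries.coeff d (term n) = 0 := by
  have hd : (MvPowerSeries.X 0 : MvPowerSeries (Fin 2) ℤ) ^ n ∣ term n := by
    rw [term_eq]
    exact (pow_dvd_qfac t n).mul_left _
  exact MvPowerSeries.X_pow_dvd_iff.1 hd d h

lemma hasSum_term : HasSum term
    (fun d => ∑ n ∈ Finset.range (d 0 + 1), MvPowerSeries.coeff d (term n) :
      MvPowerSeries (Fin 2) ℤ) := by
  refine Pi.hasSum.2 fun d => ?_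
  exact hasSum_sum_of_ne_finset_zero (f := fun n => MvPowerSeries.coeff d (term n)) fun n hn =>
    coeff_term_eq_zero (by rw [Finset.mem_range] at hn; omega)

lemma coeff_tsum_term {N : ℕ} {d : Fin 2 →₀ ℕ} (h : d 0 ≤ N) :
    MvPowerSeries.coeff d (∑' n, term n)
      = ∑ n ∈ Finset.range (N + 1), MvPowerSeries.coeff d (term n) := by
  rw [hasSum_term.tsum_eq]
  refine Finset.sum_subset (Finset.range_mono (by omega)) fun n _ hn => ?_
  exact coeff_term_eq_zero (by rw [Finset.mem_range] at hn; omega)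

lemma coeff_sum_monomials (c : ℕ → ℕ → ℕ) {N : ℕ} {d : Fin 2 →₀ ℕ} (h0 : d 0 ≤ N)
    (h1 : d 1 ≤ N) :
    MvPowerSeries.coeff d (∑ n ∈ Finset.range (N + 1), ∑ k ∈ Finset.range (N + 1),
      (c n k : MvPowerSeries (Fin 2) ℤ) * (t ^ n * z ^ k)) = c (d 0) (d 1) := by
  have hmon (n k : ℕ) : MvPowerSeries.coeff d ((c n k : MvPowerSeries (Fin 2) ℤ) * (t ^ n * z ^ k))
      = if n = d 0 ∧ k = d 1 then (c n k : ℤ) else 0 := by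
    have hd : d = Finsupp.single 0 n + Finsupp.single 1 k ↔ n = d 0 ∧ k = d 1 := by
      rw [Finsupp.ext_iff, Fin.forall_fin_two]
      simp [eq_comm]
    rw [← nsmul_eq_mul, map_nsmul, t, z, MvPowerSeries.X_pow_eq, MvPowerSeries.X_pow_eq,
      MvPowerSeries.monomial_mul_monomial, MvPowerSeries.coeff_monomial]
    simp only [hd]
    simp
  simp only [map_sum, hmon]
  rw [Finset.sum_eq_single (d 0), Finset.sum_eq_single (d 1)]
  · simp
  · intro k _ hk
    simp [hk]
  · intro h
    simp at h
    omega
  · intro n _ hn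
    simp [hn]
  · intro h
    simp at h
    omega

/-- A generating function that agrees with the partial sums modulo every power of `t` is the
infinite sum. -/
lemma genFun_eq (c : ℕ → ℕ → ℕ)
    (hc : ∀ (Q : Type) [CommRing Q] (t z u : Q) (N : ℕ), t ^ (N + 1) = 0 → (1 - z * t) * u = 1 →
      ∑ n ∈ Finset.range (N + 1), ∑ k ∈ Finset.range (N + 1), (c n k : Q) * (t ^ n * z ^ k)
        = 1 + ∑ n ∈ Finset.range (N + 1), z * t * u ^ (n + 1) * qfac t n) :
    genFun c = 1 + ∑' n, term n := by
  ext d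
  -- Multiples of t^(N+1) do not affect the coefficient at d as d 0 ≤ N, and d 1 ≤ N keeps z^(d 1)
  -- within the truncated sum.
  let N := d 0 + d 1
  let I : Ideal (MvPowerSeries (Fin 2) ℤ) := Ideal.span {t ^ (N + 1)}
  have hq := hc (MvPowerSeries (Fin 2) ℤ ⧸ I) (Ideal.Quotient.mk I t) (Ideal.Quotient.mk I z)
    (Ideal.Quotient.mk I (MvPowerSeries.invOfUnit (1 - z * t) 1)) N
    (by rw [← map_pow]; exact Ideal.Quotient.eq_zero_iff_mem.2 (Ideal.mem_span_singleton_self _))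
    (by rw [← map_mul, ← map_one (Ideal.Quotient.mk I), ← map_sub, ← map_mul, one_sub_mul_inv])
  have hqfac (n : ℕ) : qfac (Ideal.Quotient.mk I t) n = Ideal.Quotient.mk I (qfac t n) := by
    simp [qfac]
  simp only [hqfac, ← map_natCast (Ideal.Quotient.mk I), ← map_pow, ← map_mul, ← map_sum] at hq
  rw [← map_one (Ideal.Quotient.mk I), ← map_add, Ideal.Quotient.eq,
    Ideal.mem_span_singleton] at hq
  have h := MvPowerSeries.X_pow_dvd_iff.1 hq d (by omega)
  rw [map_sub, sub_eq_zero, coeff_sum_monomials c (by omega) (by omega)] at h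
  rw [map_add, coeff_tsum_term (N := N) (by omega)]
  simp only [← term_eq, map_add, map_sum] at h
  exact h

end PowerSeries

end FishburnMin

/- The infinite sum is taken coefficientwise: the topology on power series is the product topology
of the discrete topology of `ℤ`. -/
theorem theorem4p2 :
    Summable FishburnMin.term ∧
      FishburnMin.genFun FishburnMin.posetCount = 1 + ∑' n : ℕ, FishburnMin.term n ∧
      FishburnMin.genFun FishburnMin.ascentCount = 1 + ∑' n : ℕ, FishburnMin.term n :=
  ⟨FishburnMin.hasSum_term.summable,
    FishburnMin.genFun_eq _ fun _ _ _ _ _ _ ht hu => FishburnMin.sum_posetCount ht hu,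
    FishburnMin.genFun_eq _ fun _ _ _ _ _ _ ht hu => FishburnMin.sum_ascentCount ht hu⟩
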